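/- Let $(\Omega,\mathcal F,\mathbb P)$ be a probability space and $(S,\mathcal S,\mu)$ a measure space such that $\mu$ is atomless, i.e. there is no $M\in\mathcal S$ with $\mu(M)>0$ such that every measurable $C\subset M$ satisfies $\mu(C)=0$ or $\mu(C)=\mu(M)$. Let $\xi$ be a random measure on $S$, i.e. a map $\xi:\Omega\times\mathcal S\to[0,\infty]$ such that $\xi(\omega,\cdot)$ is a measure for each $\omega$ and $\xi(\cdot,M)$ is measurable for each $M\in\mathcal S$. Assume that $\xi$ is $\mu$-exchangeable, i.e. $(\xi(A_1),\dots,\xi(A_n))$ and $(\xi(B_1),\dots,\xi(B_n))$ have the same distribution for all $n\ge 1$, all disjoint $A_1,\dots,A_n\in\mathcal S$ and all disjoint $B_1,\dots,B_n\in\mathcal S$ with $\mu(A_j)=\mu(B_j)$ for $1\le j\le n$. A $\mu$-sequence is an increasing sequence $(A_n)_{n\ge1}$ in $\mathcal S$ with $\mu(A_n)<\infty$ for all $n$ and $\mu(A_n)\to\infty$. It is called $\xi$-integrable if $\mathbb E\,\xi(A_n)<\infty$ for all $n$. (a) For each $\xi$-integrable $\mu$-sequence $(A_n)$ there exists an (integrable,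 real-valued) random variable $X$ such that $\xi(A_n)/\mu(A_n)\to X$ almost surely and in $L^1$ as $n\to\infty$. (b) Assume that $\mu$ is $\sigma$-finite and that there is $C\in\mathcal S$ with $0<\mu(C)<\infty$ and $\mathbb E\,\xi(C)<\infty$. Then every $\mu$-sequence is $\xi$-integrable, and the limit in (a) is the same for all $\mu$-sequences: there is one integrable random variable $X$ such that $\xi(A_n)/\mu(A_n)\to X$ almost surely and in $L^1$ for every $\mu$-sequence $(A_n)$. -/

import Mathlib

open MeasureTheory ProbabilityTheory Filter Topology
open scoped ENNReal

namespace RandomMeasure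

variable {Ω S : Type*} [MeasurableSpace Ω] [MeasurableSpace S]

/-- `M` is an atom of `μ`: it has positive measure and each measurable subset of `M` has measure
`0` or `μ M`. (So a set of infinite measure all of whose measurable subsets have measure
`0` or `∞` is an atom.) -/
def IsMeasureAtom (μ : Measure S) (M : Set S) : Prop :=
  MeasurableSet M ∧ 0 < μ M ∧ ∀ C, MeasurableSet C → C ⊆ M → μ C = 0 ∨ μ C = μ M

/-- `μ` has no atoms. -/
def IsAtomless (μ : Measure S) : Prop :=
  ∀ M : Set S, ¬ IsMeasureAtom μ M

/-- A random measure on `S` is a kernel from the probability space `Ω` to `S`: for every `ω` it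
gives a measure `ξ ω` (with values in `[0, ∞]`) and `ω ↦ ξ ω M` is measurable for all measurable
`M`. It is `μ`-exchangeable if `(ξ (A 1), …, ξ (A n))` and `(ξ (B 1), …, ξ (B n))` have
the same distribution for all disjoint `A 1, …, A n` and disjoint `B 1, …, B n` with
`μ (A j) = μ (B j)`. -/
def IsExchangeable (P : Measure Ω) (μ : Measure S) (ξ : Kernel Ω S) : Prop :=
  ∀ (n : ℕ) (A B : Fin n → Set S),
    (∀ j, MeasurableSet (A j)) → (∀ j, MeasurableSet (B j)) →
    Pairwise (fun i j => Disjoint (A i) (A j)) →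
    Pairwise (fun i j => Disjoint (B i) (B j)) →
    (∀ j, μ (A j) = μ (B j)) →
    IdentDistrib (fun (ω : Ω) (j : Fin n) => ξ ω (A j)) (fun (ω : Ω) (j : Fin n) => ξ ω (B j)) P P

/-- An increasing sequence of measurable sets of finite measure whose measures tend to `∞`. -/
structure IsMuSequence (μ : Measure S) (A : ℕ → Set S) : Prop where
  measurableSet : ∀ n, MeasurableSet (A n)
  mono : Monotone A
  measure_lt_top : ∀ n, μ (A n) < ∞
  tendsto_measure : Tendsto (fun n => μ (A n)) atTop (𝓝 ∞)

/-- The sequence `A` is `ξ`-integrable: `E ξ (A n) < ∞` for all `n`. -/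
def IsIntegrableSeq (P : Measure Ω) (ξ : Kernel Ω S) (A : ℕ → Set S) : Prop :=
  ∀ n, ∫⁻ ω, ξ ω (A n) ∂P < ∞

/-- `ξ (A n) / μ (A n) → X` almost surely and in `L¹`. It is used for `ξ`-integrable
`μ`-sequences, where `ξ (A n)` is almost surely finite for all `n`, and `μ (A n)` is finite for all
`n` and positive for all large `n`, so that the real-valued quotient is the true one. -/
def ErgodicConv (P : Measure Ω) (μ : Measure S) (ξ : Kernel Ω S) (A : ℕ → Set S) (X : Ω → ℝ) :
    Prop :=
  (∀ᵐ ω ∂P, Tendsto (fun n => (ξ ω).real (A n) / μ.real (A n)) atTop (𝓝 (X ω))) ∧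
  Tendsto (fun n => eLpNorm (fun ω => (ξ ω).real (A n) / μ.real (A n) - X ω) 1 P) atTop (𝓝 0)

end RandomMeasure

/-! The averages `ξ (A n) / μ (A n)` form a reverse martingale for the σ-algebras generated by the
tails `ξ (A i)`, `i ≥ j`. For a tail event `G`, exchangeability makes `E[ξ M; G]` depend only on `μ
M` when `M ⊆ A j` (`setLIntegral_eq`). Atomlessness turns this into proportionality to `μ` on `A j`
(`measureReal_mul_eq`), which is the martingale identity `condExp_tailSigma`. Reverse martingale
convergence then gives (a).

For (b), cutting sets into pieces of measure at most `μ C` gives integrability. Two μ-sequences are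
compared through their union, so nested sequences `A n ⊆ U n` suffice (`limit_ae_eq_of_subset`).
There some `V` with `μ V = μ (U n)` is inserted between `A n` and a later `A m`. The pairs `(ξ (A
n), ξ V)` and `(ξ (A n), ξ (U n))` have the same law, and the `V`-average is controlled by the
`L¹`-Cauchy property along `A`. Hence the averages over `A n` and `U n` merge in `L¹`. -/

namespace RandomMeasure

/-! ### Atomless measures: intermediate values and proportionality. -/

section Atomless

variable {S : Type*} [MeasurableSpace S] {μ : Measure S}

/-- A set of positive measure has a measurable subset of positive measure at most half of
the measure of the set. -/
theorem IsAtomless.exists_subset_le_half (hμ : IsAtomless μ) {E : Set S} (hE : MeasurableSet E)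
    (h0 : 0 < μ E) :
    ∃ F ⊆ E, MeasurableSet F ∧ 0 < μ F ∧ μ F ≤ μ E / 2 := by
  have h := hμ E
  simp only [IsMeasureAtom, hE, h0, true_and, not_forall, not_or] at h
  obtain ⟨C, hC, hCE, hC0, hC1⟩ := h
  have hadd : μ C + μ (E \ C) = μ E := by
    rw [measure_add_sdiff hC.nullMeasurableSet, Set.union_eq_self_of_subset_left hCE]
  by_cases hh : μ C ≤ μ E / 2
  · exact ⟨C, hCE, hC, pos_iff_ne_zero.2 hC0, hh⟩
  · refine ⟨E \ C, Set.sdiff_subset, hE.diff hC, pos_iff_ne_zero.2 ?_, ?_⟩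
    · intro h0'
      exact hC1 (by rw [← hadd, h0', add_zero])
    · by_contra! hlt
      have := ENNReal.add_lt_add (not_le.1 hh) hlt
      rw [ENNReal.add_halves, hadd] at this
      exact this.false

theorem IsAtomless.exists_subset_le (hμ : IsAtomless μ) {E : Set S} (hE : MeasurableSet E)
    (h0 : 0 < μ E) (hfin : μ E < ∞) {ε : ℝ≥0∞} (hε : 0 < ε) :
    ∃ F ⊆ E, MeasurableSet F ∧ 0 < μ F ∧ μ F ≤ ε := by
  have key : ∀ n : ℕ, ∃ F ⊆ E, MeasurableSet F ∧ 0 < μ F ∧ μ F ≤ μ E * (2⁻¹) ^ n := by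
    intro n
    induction n with
    | zero => exact ⟨E, subset_rfl, hE, h0, by simp⟩
    | succ n ih =>
      obtain ⟨F, hFE, hF, hF0, hFn⟩ := ih
      obtain ⟨G, hGF, hG, hG0, hGn⟩ :=
        hμ.exists_subset_le_half hF hF0
      refine ⟨G, hGF.trans hFE, hG, hG0, hGn.trans ?_⟩
      rw [pow_succ, ← mul_assoc, ENNReal.div_eq_inv_mul, mul_comm]
      gcongr
  have hlim : Tendsto (fun n : ℕ => μ E * (2⁻¹ : ℝ≥0∞) ^ n) atTop (𝓝 (μ E * 0)) :=
    ENNReal.Tendsto.const_mul (ENNReal.tendsto_pow_atTop_nhds_zero_of_lt_one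
      (by simp)) (Or.inr hfin.ne)
  rw [mul_zero] at hlim
  obtain ⟨n, hn⟩ := (hlim.eventually (Iic_mem_nhds hε)).exists
  obtain ⟨F, hFE, hF, hF0, hFn⟩ := key n
  exact ⟨F, hFE, hF, hF0, hFn.trans hn⟩

/-- **Sierpiński's theorem**: an atomless measure takes all intermediate values on the subsets of
a set of finite measure. -/
theorem IsAtomless.exists_subset_measure_eq (hμ : IsAtomless μ) {E : Set S} (hE : MeasurableSet E)
    (hfin : μ E < ∞) {r : ℝ≥0∞} (hr : r ≤ μ E) :
    ∃ B ⊆ E, MeasurableSet B ∧ μ B = r := by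
  have hrfin : r ≠ ∞ := (hr.trans_lt hfin).ne
  -- measurable subsets of `E` of measure at most `r`
  let T := {B : Set S // B ⊆ E ∧ MeasurableSet B ∧ μ B ≤ r}
  -- The largest mass that can be added to `B` without exceeding `r`; the greedy construction gains
  -- at least half of it at each step.
  let s : T → ℝ≥0∞ := fun B =>
    ⨆ F : {F : Set S // F ⊆ E \ B.1 ∧ MeasurableSet F ∧ μ B.1 + μ F ≤ r}, μ F.1
  have hs : ∀ B : T, s B ≠ ∞ := fun B =>
    ((iSup_le fun F => le_add_self.trans F.2.2.2).trans_lt (lt_top_iff_ne_top.2 hrfin)).ne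
  have step : ∀ B : T, ∃ B' : T, B.1 ⊆ B'.1 ∧ s B / 2 ≤ μ (B'.1 \ B.1) := by
    intro B
    by_cases h0 : s B = 0
    · exact ⟨B, subset_rfl, by simp [h0]⟩
    obtain ⟨F, hF⟩ := lt_iSup_iff.1 (ENNReal.half_lt_self h0 (hs B))
    have hd : Disjoint B.1 F.1 := Set.disjoint_sdiff_right.mono_right F.2.1
    refine ⟨⟨B.1 ∪ F.1, Set.union_subset B.2.1 (F.2.1.trans Set.sdiff_subset),
      B.2.2.1.union F.2.2.1, (measure_union_le _ _).trans F.2.2.2⟩, Set.subset_union_left, ?_⟩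
    rw [Set.union_sdiff_left, hd.symm.sdiff_eq_left]
    exact hF.le
  choose next hsub hnext using step
  let B : ℕ → T := fun n => next^[n] ⟨∅, by simp⟩
  have hB : ∀ n, B (n + 1) = next (B n) := fun n => Function.iterate_succ_apply' _ _ _
  have hmono : Monotone fun n => (B n).1 := monotone_nat_of_le_succ fun n => by
    simp only [hB]; exact hsub _
  let U := ⋃ n, (B n).1
  have hUE : U ⊆ E := Set.iUnion_subset fun n => (B n).2.1
  have hU : MeasurableSet U := MeasurableSet.iUnion fun n => (B n).2.2.1
  have hUr : μ U ≤ r := by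
    rw [hmono.measure_iUnion]; exact iSup_le fun n => (B n).2.2.2
  refine ⟨U, hUE, hU, hUr.antisymm ?_⟩
  by_contra! hlt
  have hUfin : μ U ≠ ∞ := hlt.ne_top
  have hpos : 0 < μ (E \ U) := by
    rw [measure_sdiff hUE hU.nullMeasurableSet hUfin]
    exact tsub_pos_of_lt (hlt.trans_le hr)
  -- This `F` could have been added at every stage, so every stage gained at least `μ F / 2`, which
  -- is incompatible with the bound `r`.
  obtain ⟨F, hFE, hF, hF0, hFr⟩ := hμ.exists_subset_le (hE.diff hU) hpos
    ((measure_mono Set.sdiff_subset).trans_lt hfin) (tsub_pos_of_lt hlt)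
  have hsF : ∀ n, μ F ≤ s (B n) := fun n => by
    have hBU : (B n).1 ⊆ U := Set.subset_iUnion (fun n => (B n).1) n
    refine le_iSup_of_le (⟨F, hFE.trans (Set.sdiff_subset_sdiff_right hBU), hF, ?_⟩ : {F : Set S //
      F ⊆ E \ (B n).1 ∧ MeasurableSet F ∧ μ (B n).1 + μ F ≤ r}) le_rfl
    calc μ (B n).1 + μ F ≤ μ U + (r - μ U) := add_le_add (measure_mono hBU) hFr
      _ = r := add_tsub_cancel_of_le hUr
  have hgrow : ∀ n : ℕ, n * (μ F / 2) ≤ μ (B n).1 := by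
    intro n
    induction n with
    | zero => simp
    | succ n ih =>
      have : μ (B n).1 + μ ((B (n + 1)).1 \ (B n).1) = μ (B (n + 1)).1 :=
        by rw [measure_add_sdiff (B n).2.2.1.nullMeasurableSet,
          Set.union_eq_self_of_subset_left (hmono n.le_succ)]
      rw [← this, Nat.cast_succ, add_mul, one_mul]
      refine add_le_add ih ((ENNReal.div_le_div_right (hsF n) 2).trans ?_)
      rw [hB]; exact hnext _
  obtain ⟨n, hn⟩ := ENNReal.exists_nat_mul_gt (ENNReal.half_pos hF0.ne').ne' hrfin
  exact (hn.trans_le ((hgrow n).trans (B n).2.2.2)).false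

theorem IsAtomless.exists_between_measure_eq (hμ : IsAtomless μ) {A E : Set S}
    (hA : MeasurableSet A) (hE : MeasurableSet E) (hAE : A ⊆ E) (hfin : μ E < ∞) {r : ℝ≥0∞}
    (hAr : μ A ≤ r) (hr : r ≤ μ E) :
    ∃ B, A ⊆ B ∧ B ⊆ E ∧ MeasurableSet B ∧ μ B = r := by
  have hAfin : μ A ≠ ∞ := ((measure_mono hAE).trans_lt hfin).ne
  obtain ⟨F, hFE, hF, hFr⟩ := hμ.exists_subset_measure_eq (hE.diff hA)
    ((measure_mono Set.sdiff_subset).trans_lt hfin) (r := r - μ A)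
    (by rw [measure_sdiff hAE hA.nullMeasurableSet hAfin]; exact tsub_le_tsub_right hr _)
  refine ⟨A ∪ F, Set.subset_union_left, Set.union_subset hAE (hFE.trans Set.sdiff_subset),
    hA.union hF, ?_⟩
  rw [measure_union (Set.disjoint_sdiff_right.mono_right hFE) hF, hFr, add_tsub_cancel_of_le hAr]

/-- A finite measure whose value on the subsets of `E` depends only on their `μ`-measure is
proportional to `μ` there. -/
theorem IsAtomless.measureReal_mul_eq (hμ : IsAtomless μ) {ν : Measure S} {E : Set S}
    (hE : MeasurableSet E) (hμE : μ E < ∞) (hνE : ν E < ∞)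
    (h : ∀ M M', M ⊆ E → M' ⊆ E → MeasurableSet M → MeasurableSet M' → μ M = μ M' → ν M = ν M')
    {M : Set S} (hME : M ⊆ E) (hM : MeasurableSet M) :
    ν.real M * μ.real E = ν.real E * μ.real M := by
  have fμ : ∀ {M}, M ⊆ E → μ M ≠ ∞ := fun hME => ((measure_mono hME).trans_lt hμE).ne
  have fν : ∀ {M}, M ⊆ E → ν M ≠ ∞ := fun hME => ((measure_mono hME).trans_lt hνE).ne
  -- The defect from proportionality: it is additive, vanishes on `E` and depends only on the
  -- `μ`-measure. Any uniform bound on it can be halved, so it is zero.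
  let f : Set S → ℝ := fun M => ν.real M * μ.real E - ν.real E * μ.real M
  have hadd : ∀ M M', M ⊆ E → M' ⊆ E → MeasurableSet M' → Disjoint M M' →
      f (M ∪ M') = f M + f M' := by
    intro M M' hME hME' hM' hd
    simp only [f]
    rw [measureReal_union hd hM' (fν hME) (fν hME'), measureReal_union hd hM' (fμ hME) (fμ hME')]
    ring
  -- A set no larger than its complement has a disjoint copy `M'` there, and `f (M ∪ M') = 2 * f M`.
  -- Larger sets are then handled through their complements.
  have hhalf : ∀ K : ℝ, (∀ M ⊆ E, MeasurableSet M → |f M| ≤ K) →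
      ∀ M ⊆ E, MeasurableSet M → μ M ≤ μ (E \ M) → |f M| ≤ K / 2 := by
    intro K hK M hME hM hle
    obtain ⟨M', hM'E, hM', hMM'⟩ := hμ.exists_subset_measure_eq (hE.diff hM)
      ((measure_mono Set.sdiff_subset).trans_lt hμE) hle
    have hM'E' := hM'E.trans Set.sdiff_subset
    have hff : f M' = f M := by
      simp only [f, measureReal_def, hMM', h M' M hM'E' hME hM' hM hMM']
    have := hK (M ∪ M') (Set.union_subset hME hM'E') (hM.union hM')
    rw [hadd M M' hME hM'E' hM' (Set.disjoint_sdiff_right.mono_right hM'E), hff, ← two_mul,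
      abs_mul, abs_two] at this
    linarith
  have hstep : ∀ K : ℝ, (∀ M ⊆ E, MeasurableSet M → |f M| ≤ K) →
      ∀ M ⊆ E, MeasurableSet M → |f M| ≤ K / 2 := by
    intro K hK M hME hM
    rcases le_total (μ M) (μ (E \ M)) with hle | hle
    · exact hhalf K hK M hME hM hle
    · have h1 := hhalf K hK (E \ M) Set.sdiff_subset (hE.diff hM)
        (by rwa [Set.sdiff_sdiff_cancel_left hME])
      have h2 := hadd M (E \ M) hME Set.sdiff_subset (hE.diff hM) Set.disjoint_sdiff_right
      rw [Set.union_sdiff_cancel hME] at h2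
      have h3 : f E = 0 := sub_self _
      rwa [show f M = -f (E \ M) by linarith, abs_neg]
  have hbound : ∀ n : ℕ, ∀ M ⊆ E, MeasurableSet M →
      |f M| ≤ (ν.real E * μ.real E) / 2 ^ n := by
    intro n
    induction n with
    | zero =>
      intro M hME hM
      have h1 : ν.real M ≤ ν.real E := measureReal_mono hME hνE.ne
      have h2 : μ.real M ≤ μ.real E := measureReal_mono hME hμE.ne
      have h3 := mul_le_mul_of_nonneg_right h1 (measureReal_nonneg (μ := μ) (s := E))
      have h4 := mul_le_mul_of_nonneg_left h2 (measureReal_nonneg (μ := ν) (s := E))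
      have h5 : 0 ≤ ν.real M * μ.real E := by positivity
      have h6 : 0 ≤ ν.real E * μ.real M := by positivity
      rw [pow_zero, div_one, abs_le]
      constructor <;> simp only [f] <;> linarith
    | succ n ih =>
      intro M hME hM
      rw [pow_succ, ← div_div]
      exact hstep _ ih M hME hM
  have hlim : Tendsto (fun n : ℕ => (ν.real E * μ.real E) / 2 ^ n) atTop (𝓝 0) :=
    tendsto_const_nhds.div_atTop (tendsto_pow_atTop_atTop_of_one_lt one_lt_two)
  have : |f M| ≤ 0 := ge_of_tendsto' hlim fun n => hbound n M hME hM
  exact sub_eq_zero.1 (abs_nonpos_iff.1 this)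

end Atomless

/-! ### Convergence of reverse martingales. -/

section ReverseMartingale

variable {Ω : Type*} {m0 : MeasurableSpace Ω}

/-- A sequence that is infinitely often below `a` and infinitely often above `b > a` makes
arbitrarily many upcrossings when it is read backwards. -/
theorem eventually_le_upcrossingsBefore_reverse {Y : ℕ → Ω → ℝ} {ω : Ω} {a b : ℝ} (hab : a < b)
    (ha : ∃ᶠ n in atTop, Y n ω < a) (hb : ∃ᶠ n in atTop, b < Y n ω) (k l : ℕ) :
    ∀ᶠ N in atTop, k ≤ upcrossingsBefore a b (fun i => Y (N - i)) (N + 1 - l) ω := by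
  rw [frequently_atTop] at ha hb
  induction k generalizing l with
  | zero => simp
  | succ k ih =>
    -- Read backwards, the value below `a` at `j` comes before the value above `b` at `i ≤ j`. This
    -- adds one upcrossing to those made among the indices beyond `j`; the horizon `N + 1 - l` keeps
    -- exactly the indices `≥ l`.
    obtain ⟨i, hli, hi⟩ := hb l
    obtain ⟨j, hij, hj⟩ := ha i
    filter_upwards [ih (j + 1), eventually_ge_atTop j] with N hN hjN
    have h1 := upcrossingsBefore_lt_of_exists_upcrossing (f := fun i => Y (N - i)) (ω := ω)
      (N := N - j) (N₁ := N - j) (N₂ := N - i) hab le_rfl (by simpa [Nat.sub_sub_self hjN] using hj)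
      (by omega) (by simpa [Nat.sub_sub_self (hij.trans hjN)] using hi)
    have h2 := upcrossingsBefore_mono (f := fun i => Y (N - i)) hab
      (show N - i + 1 ≤ N + 1 - l by omega) ω
    have h3 : N + 1 - (j + 1) = N - j := by omega
    rw [h3] at hN
    exact (Nat.succ_le_of_lt (hN.trans_lt h1)).trans h2

variable {P : Measure Ω} [IsProbabilityMeasure P] {m : ℕ → MeasurableSpace Ω} {Y : ℕ → Ω → ℝ}

/-- A reverse martingale up to time `N`, read backwards, is a martingale. -/
theorem martingale_reverse (hm : Antitone m) (hle : ∀ n, m n ≤ m0)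
    (hadp : ∀ n, StronglyMeasurable[m n] (Y n)) (hint : ∀ n, Integrable (Y n) P)
    (hY : ∀ n, P[Y n | m (n + 1)] =ᵐ[P] Y (n + 1)) (N : ℕ) :
    Martingale (fun i => Y (N - i))
      (⟨fun i => m (N - i), fun _ _ hij => hm (Nat.sub_le_sub_left hij N), fun _ => hle _⟩ :
        Filtration ℕ m0) P := by
  refine martingale_nat (fun i => hadp (N - i)) (fun i => hint _) fun i => ?_
  change Y (N - i) =ᵐ[P] P[Y (N - (i + 1)) | m (N - i)]
  rcases lt_or_ge i N with hi | hi
  · have h := hY (N - (i + 1))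
    rw [show N - (i + 1) + 1 = N - i by omega] at h
    exact h.symm
  -- From time `N` on, truncated subtraction freezes the process at `Y 0`.
  · rw [show N - (i + 1) = N - i by omega,
      condExp_of_stronglyMeasurable (hle _) (hadp (N - i)) (hint _)]

theorem reverse_condExp_ae_eq (hm : Antitone m) (hle : ∀ n, m n ≤ m0)
    (hadp : ∀ n, StronglyMeasurable[m n] (Y n)) (hint : ∀ n, Integrable (Y n) P)
    (hY : ∀ n, P[Y n | m (n + 1)] =ᵐ[P] Y (n + 1)) (n : ℕ) : P[Y 0 | m n] =ᵐ[P] Y n := by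
  have := (martingale_reverse hm hle hadp hint hY n).condExp_ae_eq (Nat.zero_le n)
  simpa using this

/-- **Convergence of reverse martingales**, almost surely and in `L¹`. -/
theorem exists_tendsto_of_reverse_martingale (hm : Antitone m) (hle : ∀ n, m n ≤ m0)
    (hadp : ∀ n, StronglyMeasurable[m n] (Y n)) (hint : ∀ n, Integrable (Y n) P)
    (hY : ∀ n, P[Y n | m (n + 1)] =ᵐ[P] Y (n + 1)) :
    ∃ X : Ω → ℝ, Measurable X ∧ Integrable X P ∧
      (∀ᵐ ω ∂P, Tendsto (fun n => Y n ω) atTop (𝓝 (X ω))) ∧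
      Tendsto (fun n => eLpNorm (Y n - X) 1 P) atTop (𝓝 0) := by
  have hcond := reverse_condExp_ae_eq hm hle hadp hint hY
  have hmeas : ∀ n, Measurable (Y n) := fun n => ((hadp n).mono (hle n)).measurable
  have hui : UniformIntegrable Y 1 P :=
    (uniformIntegrable_congr_ae hcond).1 ((hint 0).uniformIntegrable_condExp hle)
  obtain ⟨R, hR⟩ := hui.2.2
  have hfreq : ∀ a b : ℝ, a < b →
      ∀ᵐ ω ∂P, ¬((∃ᶠ n in atTop, Y n ω < a) ∧ ∃ᶠ n in atTop, b < Y n ω) := by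
    intro a b hab
    let U : ℕ → Ω → ℝ≥0∞ := fun N ω =>
      (upcrossingsBefore a b (fun i => Y (N - i)) (N + 1) ω : ℝ≥0∞)
    have hadp' := fun N => (martingale_reverse hm hle hadp hint hY N).stronglyAdapted
    have hU : ∀ N, Measurable (U N) := fun N =>
      measurable_from_top.comp ((hadp' N).measurable_upcrossingsBefore hab)
    -- Every reversed martingale ends at `Y 0`, so Doob's upcrossing bound is uniform in `N`, as
    -- Fatou's lemma needs below.
    have hUint : ∀ N, ∫⁻ ω, U N ω ∂P ≤ ENNReal.ofReal ((∫ ω, (Y 0 ω - a)⁺ ∂P) / (b - a)) := by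
      intro N
      have h1 := (martingale_reverse hm hle hadp hint
        hY N).submartingale.mul_integral_upcrossingsBefore_le_integral_pos_part a b (N + 1)
      have h2 : ∫⁻ ω, U N ω ∂P = ENNReal.ofReal
          (∫ ω, (upcrossingsBefore a b (fun i => Y (N - i)) (N + 1) ω : ℝ) ∂P) := by
        rw [ofReal_integral_eq_lintegral_ofReal ((hadp' N).integrable_upcrossingsBefore hab)
          (ae_of_all _ fun ω => Nat.cast_nonneg _)]
        simp [U]
      rw [h2]
      refine ENNReal.ofReal_le_ofReal ((le_div_iff₀' (sub_pos.2 hab)).2 (h1.trans_eq ?_))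
      simp [Nat.sub_eq_zero_of_le (Nat.le_succ N)]
    have hlim : ∫⁻ ω, liminf (fun N => U N ω) atTop ∂P < ∞ :=
      ((lintegral_liminf_le hU).trans (liminf_le_of_le (by isBoundedDefault) fun c hc => by
        obtain ⟨N, hN⟩ := hc.exists
        exact hN.trans (hUint N))).trans_lt ENNReal.ofReal_lt_top
    filter_upwards [ae_lt_top (.liminf hU) hlim.ne] with ω hω ⟨ha, hb⟩
    refine hω.ne (top_le_iff.1 (ENNReal.le_of_forall_nnreal_lt fun r _ => ?_))
    obtain ⟨k, hk⟩ := exists_nat_ge r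
    refine le_liminf_of_le (by isBoundedDefault) ?_
    filter_upwards [eventually_le_upcrossingsBefore_reverse hab ha hb k 0] with N hN
    calc (r : ℝ≥0∞) ≤ (k : ℝ≥0∞) := by exact_mod_cast hk
      _ ≤ U N ω := Nat.cast_le.2 hN
  have hfreq' : ∀ᵐ ω ∂P, ∀ a b : ℚ, a < b →
      ¬((∃ᶠ n in atTop, Y n ω < a) ∧ ∃ᶠ n in atTop, (b : ℝ) < Y n ω) := by
    simp only [ae_all_iff]
    exact fun a b hab => hfreq a b (Rat.cast_lt.2 hab)
  have hex : ∀ᵐ ω ∂P, ∃ c, Tendsto (fun n => Y n ω) atTop (𝓝 c) := by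
    filter_upwards [hfreq', ae_bdd_liminf_atTop_of_eLpNorm_bdd one_ne_zero hmeas hR] with ω h1 h2
    by_cases h : IsBoundedUnder (· ≤ ·) atTop fun n => |Y n ω|
    · rw [isBoundedUnder_le_abs] at h
      refine tendsto_of_no_upcrossings Rat.denseRange_cast ?_ h.1 h.2
      rintro _ ⟨a, rfl⟩ _ ⟨b, rfl⟩ hab
      exact h1 a b (Rat.cast_lt.1 hab)
    · obtain ⟨a, b, hab, h3, h4⟩ := ENNReal.exists_upcrossings_of_not_bounded_under h2.ne h
      exact absurd ⟨h3, h4⟩ (h1 a b hab)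
  obtain ⟨X, hX, hYX⟩ := measurable_limit_of_tendsto_metrizable_ae
    (fun n => (hmeas n).aemeasurable) hex
  have hXint : MemLp X 1 P := by
    refine ⟨hX.aestronglyMeasurable, (Lp.eLpNorm_lim_le_liminf_eLpNorm
      (fun n => (hmeas n).aestronglyMeasurable) X hYX).trans_lt ?_⟩
    exact (liminf_le_of_le (by isBoundedDefault) fun c hc => by
      obtain ⟨n, hn⟩ := hc.exists
      exact hn.trans (hR n)).trans_lt ENNReal.coe_lt_top
  exact ⟨X, hX, memLp_one_iff_integrable.1 hXint, hYX,
    tendsto_Lp_finite_of_tendsto_ae le_rfl ENNReal.one_ne_top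
      (fun n => (hmeas n).aestronglyMeasurable) hXint hui.2.1 hYX⟩

end ReverseMartingale

/-! ### Exchangeability and the martingale property of averages. -/

section Exchangeable

variable {Ω S : Type*} [MeasurableSpace Ω] [MeasurableSpace S] {P : Measure Ω}
  {μ : Measure S} {ξ : Kernel Ω S}

theorem measure_eq_sum_disjointed (ν : Measure S) {C : ℕ → Set S} (hC : ∀ n, MeasurableSet (C n))
    (hmono : Monotone C) (n : ℕ) :
    ν (C n) = ∑ k ∈ Finset.range (n + 1), ν (disjointed C k) := by
  rw [← measure_biUnion_finset ((disjoint_disjointed C).set_pairwise _)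
    fun k _ => MeasurableSet.disjointed hC k, biUnion_range_succ_disjointed, hmono.partialSups_eq]

/-- Along increasing sequences of sets of finite measure, the law of an exchangeable random measure
depends only on the measures of the sets. -/
theorem IsExchangeable.identDistrib_of_monotone [IsProbabilityMeasure P]
    (hξ : IsExchangeable P μ ξ) {C D : ℕ → Set S}
    (hC : ∀ n, MeasurableSet (C n)) (hD : ∀ n, MeasurableSet (D n))
    (hCm : Monotone C) (hDm : Monotone D) (hfin : ∀ n, μ (C n) < ∞) (h : ∀ n, μ (C n) = μ (D n)) :
    IdentDistrib (fun ω n => ξ ω (C n)) (fun ω n => ξ ω (D n)) P P := by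
  have hmeas : ∀ C : ℕ → Set S, (∀ n, MeasurableSet (C n)) →
      AEMeasurable (fun ω n => ξ ω (C n)) P := fun C hC =>
    (measurable_pi_lambda _ fun n => ξ.measurable_coe (hC n)).aemeasurable
  have hdis : ∀ n, μ (disjointed C n) = μ (disjointed D n) := by
    intro n
    cases n with
    | zero => simpa using h 0
    | succ n =>
      rw [← Order.succ_eq_add_one, hCm.disjointed_succ (not_isMax n),
        hDm.disjointed_succ (not_isMax n), Order.succ_eq_add_one,
        measure_sdiff (hCm (Nat.le_add_right n 1)) (hC n).nullMeasurableSet (hfin n).ne,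
        measure_sdiff (hDm (Nat.le_add_right n 1)) (hD n).nullMeasurableSet (h n ▸ (hfin n).ne), h, h]
  rw [identDistrib_iff_forall_finset_identDistrib (hmeas C hC) (hmeas D hD)]
  intro I
  let N := I.sup id + 1
  have base := hξ N (fun j => disjointed C j) (fun j => disjointed D j)
    (fun j => MeasurableSet.disjointed hC j) (fun j => MeasurableSet.disjointed hD j)
    (fun i j hij => disjoint_disjointed C (Fin.val_injective.ne hij))
    (fun i j hij => disjoint_disjointed D (Fin.val_injective.ne hij)) (fun j => hdis j)
  -- Partial sums recover the values on the increasing sets from those on the disjoint increments.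
  let g : (Fin N → ℝ≥0∞) → (I → ℝ≥0∞) := fun v i => ∑ k : Fin N, if k.1 ≤ i.1 then v k else 0
  have hg : Measurable g := by
    refine measurable_pi_lambda _ fun i => Finset.measurable_sum _ fun k _ => ?_
    split_ifs
    · exact measurable_pi_apply k
    · exact measurable_const
  have hgC : ∀ C : ℕ → Set S, (∀ n, MeasurableSet (C n)) → Monotone C →
      (g ∘ fun ω (j : Fin N) => ξ ω (disjointed C j)) = fun ω => I.restrict fun n => ξ ω (C n) := by
    intro C hC hCm
    ext ω i
    have hi : i.1 < N := Nat.lt_succ_of_le (Finset.le_sup (f := id) i.2)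
    simp only [g, Function.comp_apply, Finset.restrict]
    rw [Fin.sum_univ_eq_sum_range (fun k => if k ≤ i.1 then ξ ω (disjointed C k) else 0) N,
      measure_eq_sum_disjointed _ hC hCm, ← Finset.sum_filter]
    refine Finset.sum_congr ?_ fun _ _ => rfl
    ext k
    simp only [Finset.mem_filter, Finset.mem_range]
    omega
  have := base.comp hg
  rwa [hgC C hC hCm, hgC D hD hDm] at this

/-- The `σ`-algebra generated by `ξ (A i)` for `i ≥ j`. -/
@[reducible]
def tailSigma (ξ : Kernel Ω S) (A : ℕ → Set S) (j : ℕ) : MeasurableSpace Ω :=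
  MeasurableSpace.comap (fun ω i => ξ ω (A (j + i))) inferInstance

theorem tailSigma_le {A : ℕ → Set S} (hA : ∀ n, MeasurableSet (A n)) (j : ℕ) :
    tailSigma ξ A j ≤ ‹MeasurableSpace Ω› :=
  (measurable_pi_lambda _ fun _ => ξ.measurable_coe (hA _)).comap_le

theorem measurable_tailSigma (ξ : Kernel Ω S) (A : ℕ → Set S) {j n : ℕ} (hjn : j ≤ n) :
    Measurable[tailSigma ξ A j] fun ω => ξ ω (A n) := by
  obtain ⟨i, rfl⟩ := Nat.exists_eq_add_of_le hjn
  exact (measurable_pi_apply i).comp (comap_measurable fun ω i => ξ ω (A (j + i)))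

theorem antitone_tailSigma (ξ : Kernel Ω S) (A : ℕ → Set S) : Antitone (tailSigma ξ A) :=
  fun _ _ hij => Measurable.comap_le <| @measurable_pi_lambda _ _ _ (tailSigma ξ A _) _ _
    fun k => measurable_tailSigma ξ A (hij.trans (Nat.le_add_right _ k))

/-- Given the values of `ξ` on supersets of `A j`, the expected value of `ξ M` depends only on the
measure of the subset `M` of `A j`. -/
theorem IsExchangeable.setLIntegral_eq [IsProbabilityMeasure P] (hξ : IsExchangeable P μ ξ)
    {A : ℕ → Set S} (hA : ∀ n, MeasurableSet (A n)) (hmono : Monotone A) (hfin : ∀ n, μ (A n) < ∞)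
    {j : ℕ} {G : Set Ω} (hG : MeasurableSet[tailSigma ξ A j] G) {M M' : Set S} (hM : M ⊆ A j)
    (hM' : M' ⊆ A j) (hMm : MeasurableSet M) (hMm' : MeasurableSet M') (h : μ M = μ M') :
    ∫⁻ ω in G, ξ ω M ∂P = ∫⁻ ω in G, ξ ω M' ∂P := by
  have hG' := tailSigma_le hA j G hG
  obtain ⟨T, hT, rfl⟩ := hG
  -- Prepending `M` to the tail of `A` keeps the sequence increasing, so the joint law of `ξ M` and
  -- the tail depends only on `μ M`.
  let C : Set S → ℕ → Set S := fun M n => Nat.casesOn n M fun i => A (j + i)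
  have hCm : ∀ M ⊆ A j, Monotone (C M) := fun M hM => monotone_nat_of_le_succ fun n => by
    cases n with
    | zero => exact hM
    | succ n => exact hmono (Nat.le_succ _)
  have hC : ∀ M, MeasurableSet M → ∀ n, MeasurableSet (C M n) := fun M hM n => by
    cases n with
    | zero => exact hM
    | succ n => exact hA _
  have hid := hξ.identDistrib_of_monotone (hC M hMm) (hC M' hMm') (hCm M hM) (hCm M' hM')
    (fun n => by
      cases n with
      | zero => exact (measure_mono hM).trans_lt (hfin j)
      | succ n => exact hfin _)
    (fun n => by
      cases n with
      | zero => exact h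
      | succ n => rfl)
  let φ : (ℕ → ℝ≥0∞) → ℝ≥0∞ := ((fun v i => v (i + 1)) ⁻¹' T).indicator fun v => v 0
  have hφ : Measurable φ := (measurable_pi_apply 0).indicator
    ((measurable_pi_lambda _ fun i => measurable_pi_apply (i + 1)) hT)
  have := (hid.comp hφ).lintegral_eq
  rw [← lintegral_indicator hG', ← lintegral_indicator hG']
  exact this

/-- On a tail event `G`, the measure `M ↦ E[ξ M; G]` is proportional to `μ` inside `A j`, so the
averages over `A n` and `A j` have the same integral over `G`. -/
theorem IsExchangeable.condExp_tailSigma [IsProbabilityMeasure P] (hμ : IsAtomless μ)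
    (hξ : IsExchangeable P μ ξ)
    {A : ℕ → Set S} (hA : ∀ n, MeasurableSet (A n)) (hmono : Monotone A) (hfin : ∀ n, μ (A n) < ∞)
    (h0 : ∀ n, 0 < μ (A n)) (hint : IsIntegrableSeq P ξ A) {n j : ℕ} (hnj : n ≤ j) :
    P[fun ω => (ξ ω).real (A n) / μ.real (A n) | tailSigma ξ A j] =ᵐ[P]
      fun ω => (ξ ω).real (A j) / μ.real (A j) := by
  have hintr : ∀ n, Integrable (fun ω => (ξ ω).real (A n)) P := fun n =>
    integrable_toReal_of_lintegral_ne_top (ξ.measurable_coe (hA n)).aemeasurable (hint n).ne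
  refine (ae_eq_condExp_of_forall_setIntegral_eq (tailSigma_le hA j) ((hintr n).div_const _)
    (fun _ _ _ => ((hintr j).div_const _).integrableOn) (fun G hG _ => ?_) ?_).symm
  · let ν : Measure S := (P.restrict G).bind ξ
    have hν : ∀ M, MeasurableSet M → ν M = ∫⁻ ω in G, ξ ω M ∂P := fun M hM =>
      Measure.bind_apply hM ξ.measurable.aemeasurable
    have hνr : ∀ n, ∫ ω in G, (ξ ω).real (A n) ∂P = ν.real (A n) := fun n => by
      rw [measureReal_def, hν _ (hA n)]
      exact integral_toReal (ξ.measurable_coe (hA n)).aemeasurable.restrict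
        (ae_restrict_of_ae (ae_lt_top (ξ.measurable_coe (hA n)) (hint n).ne))
    have key := hμ.measureReal_mul_eq (ν := ν) (hA j) (hfin j)
      (by rw [hν _ (hA j)]; exact (setLIntegral_le_lintegral _ _).trans_lt (hint j))
      (fun M M' hM hM' hMm hMm' h => by
        rw [hν _ hMm, hν _ hMm']
        exact hξ.setLIntegral_eq hA hmono hfin hG hM hM' hMm hMm' h) (hmono hnj) (hA n)
    rw [integral_div, integral_div, hνr, hνr]
    refine (div_eq_div_iff
      (ENNReal.toReal_pos (h0 j).ne' (hfin j).ne).ne'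
      (ENNReal.toReal_pos (h0 n).ne' (hfin n).ne).ne').2 key.symm
  · exact (((measurable_tailSigma ξ A le_rfl).ennreal_toReal).div_const
      _).stronglyMeasurable.aestronglyMeasurable

/-- The ergodic theorem along a `ξ`-integrable `μ`-sequence. -/
theorem IsExchangeable.exists_ergodicConv [IsProbabilityMeasure P] (hμ : IsAtomless μ)
    (hξ : IsExchangeable P μ ξ) {A : ℕ → Set S} (hA : IsMuSequence μ A)
    (hint : IsIntegrableSeq P ξ A) :
    ∃ X : Ω → ℝ, Measurable X ∧ Integrable X P ∧ ErgodicConv P μ ξ A X := by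
  obtain ⟨k, hk⟩ := (hA.tendsto_measure.eventually (lt_mem_nhds ENNReal.zero_lt_top)).exists
  -- The shift discards the initial sets that may have measure zero.
  let B : ℕ → Set S := fun n => A (n + k)
  have hB : ∀ n, MeasurableSet (B n) := fun n => hA.measurableSet _
  have hBm : Monotone B := fun i j hij => hA.mono (Nat.add_le_add_right hij k)
  have hBint : IsIntegrableSeq P ξ B := fun n => hint _
  have hB0 : ∀ n, 0 < μ (B n) := fun n => hk.trans_le (measure_mono (hA.mono (Nat.le_add_left k n)))
  obtain ⟨X, hX, hXint, hae, hL1⟩ := exists_tendsto_of_reverse_martingale (P := P)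
    (Y := fun n ω => (ξ ω).real (B n) / μ.real (B n)) (antitone_tailSigma ξ B) (tailSigma_le hB)
    (fun n => (((measurable_tailSigma ξ B le_rfl).ennreal_toReal).div_const _).stronglyMeasurable)
    (fun n => (integrable_toReal_of_lintegral_ne_top (ξ.measurable_coe (hB n)).aemeasurable
      (hBint n).ne).div_const _)
    (fun n => hξ.condExp_tailSigma hμ hB hBm (fun n => hA.measure_lt_top _) hB0 hBint n.le_succ)
  refine ⟨X, hX, hXint, ?_, ?_⟩
  · filter_upwards [hae] with ω hω
    exact (tendsto_add_atTop_iff_nat k).1 hω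
  · exact (tendsto_add_atTop_iff_nat k).1 hL1

end Exchangeable

/-! ### Integrability and independence of the limit from the sequence. -/

section Limit

variable {Ω S : Type*} [MeasurableSpace Ω] [MeasurableSpace S] {P : Measure Ω}
  {μ : Measure S} {ξ : Kernel Ω S}

theorem IsExchangeable.lintegral_eq (hξ : IsExchangeable P μ ξ) {A B : Set S}
    (hA : MeasurableSet A) (hB : MeasurableSet B) (h : μ A = μ B) :
    ∫⁻ ω, ξ ω A ∂P = ∫⁻ ω, ξ ω B ∂P :=
  ((hξ 1 (fun _ => A) (fun _ => B) (fun _ => hA) (fun _ => hB)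
    (fun i j hij => absurd (Subsingleton.elim i j) hij)
    (fun i j hij => absurd (Subsingleton.elim i j) hij) (fun _ => h)).comp
    (measurable_pi_apply 0)).lintegral_eq

/-- If `ξ` has finite expectation on one set of positive finite measure, then so it has on all sets
of finite measure. -/
theorem IsExchangeable.lintegral_lt_top (hμ : IsAtomless μ) (hξ : IsExchangeable P μ ξ)
    {C : Set S} (hC : MeasurableSet C) (hC0 : 0 < μ C) (hCfin : μ C < ∞)
    (hCint : ∫⁻ ω, ξ ω C ∂P < ∞) {A : Set S} (hA : MeasurableSet A) (hAfin : μ A < ∞) :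
    ∫⁻ ω, ξ ω A ∂P < ∞ := by
  have hsmall : ∀ A, MeasurableSet A → μ A ≤ μ C → ∫⁻ ω, ξ ω A ∂P < ∞ := by
    intro A hA hle
    obtain ⟨B, hBC, hB, hBA⟩ := hμ.exists_subset_measure_eq hC hCfin hle
    rw [hξ.lintegral_eq hA hB hBA.symm]
    exact (lintegral_mono fun ω => measure_mono hBC).trans_lt hCint
  have key : ∀ (k : ℕ) (A : Set S), MeasurableSet A → μ A ≤ k * μ C → ∫⁻ ω, ξ ω A ∂P < ∞ := by
    intro k
    induction k with
    | zero => exact fun A hA hle => hsmall A hA (hle.trans (by simp))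
    | succ k ih =>
      intro A hA hle
      rcases le_total (μ A) (μ C) with h | h
      · exact hsmall A hA h
      · have hAfin : μ A < ∞ := hle.trans_lt (ENNReal.mul_lt_top (by simp) hCfin)
        obtain ⟨B, hBA, hB, hBC⟩ := hμ.exists_subset_measure_eq hA hAfin h
        have hdiff : ∫⁻ ω, ξ ω (A \ B) ∂P < ∞ := by
          refine ih _ (hA.diff hB) ?_
          rw [measure_sdiff hBA hB.nullMeasurableSet (hBC ▸ hCfin.ne), hBC]
          refine tsub_le_iff_right.2 (hle.trans_eq ?_)
          rw [Nat.cast_succ, add_mul, one_mul]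
        calc ∫⁻ ω, ξ ω A ∂P ≤ ∫⁻ ω, (ξ ω B + ξ ω (A \ B)) ∂P := lintegral_mono fun ω => by
              refine (measure_mono ?_).trans (measure_union_le _ _)
              rw [Set.union_sdiff_cancel hBA]
          _ = ∫⁻ ω, ξ ω B ∂P + ∫⁻ ω, ξ ω (A \ B) ∂P :=
              lintegral_add_left (ξ.measurable_coe hB) _
          _ < ∞ := ENNReal.add_lt_top.2 ⟨hsmall B hB hBC.le, hdiff⟩
  obtain ⟨k, hk⟩ := ENNReal.exists_nat_mul_gt hC0.ne' hAfin.ne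
  exact key k A hA hk.le

/-- The average `ξ A / μ A`. -/
noncomputable def average (μ : Measure S) (ξ : Kernel Ω S) (A : Set S) (ω : Ω) : ℝ :=
  (ξ ω).real A / μ.real A

theorem measurable_average {A : Set S} (hA : MeasurableSet A) : Measurable (average μ ξ A) :=
  (ξ.measurable_coe hA).ennreal_toReal.div_const _

theorem integrable_average {A : Set S} (hA : MeasurableSet A) (hint : ∫⁻ ω, ξ ω A ∂P < ∞) :
    Integrable (average μ ξ A) P :=
  (integrable_toReal_of_lintegral_ne_top (ξ.measurable_coe hA).aemeasurable hint.ne).div_const _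

/-- Conditioning on `(ξ V, ξ B)` sends the `A`-average to the `V`-average, fixes the `B`-average and
contracts `L¹`. -/
theorem IsExchangeable.eLpNorm_average_sub_le [IsProbabilityMeasure P]
    (hμ : IsAtomless μ) (hξ : IsExchangeable P μ ξ)
    {A V B : Set S} (hA : MeasurableSet A) (hV : MeasurableSet V) (hB : MeasurableSet B)
    (hAV : A ⊆ V) (hVB : V ⊆ B) (hA0 : 0 < μ A) (hBfin : μ B < ∞)
    (hBint : ∫⁻ ω, ξ ω B ∂P < ∞) :
    eLpNorm (average μ ξ V - average μ ξ B) 1 P ≤ eLpNorm (average μ ξ A - average μ ξ B) 1 P := by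
  let Z : ℕ → Set S
    | 0 => A
    | 1 => V
    | _ + 2 => B
  have hZ : ∀ n, MeasurableSet (Z n)
    | 0 => hA
    | 1 => hV
    | _ + 2 => hB
  have hZm : Monotone Z := monotone_nat_of_le_succ fun
    | 0 => hAV
    | 1 => hVB
    | _ + 2 => subset_rfl
  have hZB : ∀ n, Z n ⊆ B
    | 0 => hAV.trans hVB
    | 1 => hVB
    | _ + 2 => subset_rfl
  have hZint : IsIntegrableSeq P ξ Z := fun n =>
    (lintegral_mono fun ω => measure_mono (hZB n)).trans_lt hBint
  have h1 : P[average μ ξ A | tailSigma ξ Z 1] =ᵐ[P] average μ ξ V :=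
    hξ.condExp_tailSigma hμ hZ hZm (fun n => (measure_mono (hZB n)).trans_lt hBfin)
      (fun n => hA0.trans_le (measure_mono (hZm (Nat.zero_le n)))) hZint (Nat.zero_le 1)
  have h2 : P[average μ ξ B | tailSigma ξ Z 1] = average μ ξ B :=
    condExp_of_stronglyMeasurable (tailSigma_le hZ 1)
      (((measurable_tailSigma ξ Z one_le_two).ennreal_toReal).div_const _).stronglyMeasurable
      (integrable_average hB hBint)
  have h3 := condExp_sub (integrable_average (μ := μ) hA (hZint 0))
    (integrable_average (μ := μ) hB hBint) (tailSigma ξ Z 1)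
  have h4 : P[average μ ξ A - average μ ξ B | tailSigma ξ Z 1] =ᵐ[P]
      average μ ξ V - average μ ξ B := by
    refine h3.trans ?_
    rw [h2]
    exact h1.sub .rfl
  rw [← eLpNorm_congr_ae h4]
  exact eLpNorm_condExp_le_eLpNorm _ le_rfl

/-- The distance is a function of the law of `(ξ A, ξ U)`, which by exchangeability is that of `(ξ
A, ξ V)`. -/
theorem IsExchangeable.eLpNorm_average_sub_eq [IsProbabilityMeasure P] (hξ : IsExchangeable P μ ξ)
    {A U V : Set S} (hA : MeasurableSet A) (hU : MeasurableSet U) (hV : MeasurableSet V)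
    (hAU : A ⊆ U) (hAV : A ⊆ V) (hUfin : μ U < ∞) (h : μ U = μ V) :
    eLpNorm (average μ ξ A - average μ ξ U) 1 P = eLpNorm (average μ ξ A - average μ ξ V) 1 P := by
  let Z : Set S → ℕ → Set S := fun U n => Nat.casesOn n A fun _ => U
  have hZ : ∀ U, MeasurableSet U → ∀ n, MeasurableSet (Z U n) := fun U hU n => by
    cases n with
    | zero => exact hA
    | succ n => exact hU
  have hZm : ∀ U, A ⊆ U → Monotone (Z U) := fun U hU => monotone_nat_of_le_succ fun n => by
    cases n with
    | zero => exact hU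
    | succ n => exact subset_rfl
  have hid := hξ.identDistrib_of_monotone (hZ U hU) (hZ V hV) (hZm U hAU) (hZm V hAV)
    (fun n => by
      cases n with
      | zero => exact (measure_mono hAU).trans_lt hUfin
      | succ n => exact hUfin)
    (fun n => by
      cases n with
      | zero => rfl
      | succ n => exact h)
  have hg : Measurable fun v : ℕ → ℝ≥0∞ => (v 0).toReal / μ.real A - (v 1).toReal / μ.real U := by
    fun_prop
  have key := (hid.comp hg).eLpNorm_eq (p := 1)
  have hUV : average μ ξ V = fun ω => (ξ ω).real V / μ.real U := by
    rw [measureReal_def, h, ← measureReal_def]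
    rfl
  rw [hUV]
  exact key

/-- Nested `μ`-sequences have the same limit. -/
theorem IsExchangeable.limit_ae_eq_of_subset [IsProbabilityMeasure P]
    (hμ : IsAtomless μ) (hξ : IsExchangeable P μ ξ)
    {A U : ℕ → Set S} (hA : IsMuSequence μ A) (hU : IsMuSequence μ U) (hAU : ∀ n, A n ⊆ U n)
    (hAint : IsIntegrableSeq P ξ A) {X Y : Ω → ℝ}
    (hX : Integrable X P) (hY : Integrable Y P) (hAX : ErgodicConv P μ ξ A X)
    (hUY : ErgodicConv P μ ξ U Y) : X =ᵐ[P] Y := by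
  have hAX' : Tendsto (fun n => eLpNorm (average μ ξ (A n) - X) 1 P) atTop (𝓝 0) := hAX.2
  have hUY' : Tendsto (fun n => eLpNorm (average μ ξ (U n) - Y) 1 P) atTop (𝓝 0) := hUY.2
  -- A later `A m` is large enough to contain a copy of `U n` that still contains `A n`.
  have hm : ∀ n, ∃ m, n ≤ m ∧ μ (U n) ≤ μ (A m) := fun n =>
    ((eventually_ge_atTop n).and
      (hA.tendsto_measure.eventually (le_mem_nhds (hU.measure_lt_top n)))).exists
  choose m hnm hm using hm
  have hmt : Tendsto m atTop atTop := tendsto_atTop_mono hnm tendsto_id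
  have hmA : ∀ n, AEStronglyMeasurable (average μ ξ (A n)) P := fun n =>
    (measurable_average (hA.measurableSet n)).aestronglyMeasurable
  have hmU : ∀ n, AEStronglyMeasurable (average μ ξ (U n)) P := fun n =>
    (measurable_average (hU.measurableSet n)).aestronglyMeasurable
  have htri : ∀ {f g h : Ω → ℝ}, AEStronglyMeasurable f P → AEStronglyMeasurable g P →
      AEStronglyMeasurable h P → eLpNorm (f - h) 1 P ≤ eLpNorm (f - g) 1 P + eLpNorm (g - h) 1 P := by
    intro f g h hf hg hh
    rw [← sub_add_sub_cancel f g h]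
    exact eLpNorm_add_le (hf.sub hg) (hg.sub hh) le_rfl
  have hAA : ∀ n k, eLpNorm (average μ ξ (A n) - average μ ξ (A k)) 1 P ≤
      eLpNorm (average μ ξ (A n) - X) 1 P + eLpNorm (average μ ξ (A k) - X) 1 P := fun n k => by
    rw [eLpNorm_sub_comm (average μ ξ (A k)) X]
    exact htri (hmA n) hX.1 (hmA k)
  have hstep : ∀ᶠ n in atTop, eLpNorm (average μ ξ (A n) - average μ ξ (U n)) 1 P ≤
      2 * (eLpNorm (average μ ξ (A n) - X) 1 P + eLpNorm (average μ ξ (A (m n)) - X) 1 P) := by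
    filter_upwards [hA.tendsto_measure.eventually (lt_mem_nhds ENNReal.zero_lt_top)] with n hn
    obtain ⟨V, hAV, hVA, hV, hVU⟩ := hμ.exists_between_measure_eq (hA.measurableSet n)
      (hA.measurableSet (m n)) (hA.mono (hnm n)) (hA.measure_lt_top _)
      (measure_mono (hAU n)) (hm n)
    rw [hξ.eLpNorm_average_sub_eq (hA.measurableSet n) (hU.measurableSet n) hV (hAU n) hAV
      (hU.measure_lt_top n) hVU.symm, two_mul]
    refine (htri (hmA n) (hmA (m n)) (measurable_average hV).aestronglyMeasurable).trans
      (add_le_add (hAA _ _) ?_)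
    rw [eLpNorm_sub_comm]
    exact (hξ.eLpNorm_average_sub_le hμ (hA.measurableSet n) hV (hA.measurableSet _) hAV hVA hn
      (hA.measure_lt_top _) (hAint _)).trans (hAA _ _)
  have hle : ∀ᶠ n in atTop, eLpNorm (X - Y) 1 P ≤ eLpNorm (average μ ξ (A n) - X) 1 P +
      (2 * (eLpNorm (average μ ξ (A n) - X) 1 P + eLpNorm (average μ ξ (A (m n)) - X) 1 P) +
        eLpNorm (average μ ξ (U n) - Y) 1 P) := by
    filter_upwards [hstep] with n hn
    refine (htri hX.1 (hmA n) hY.1).trans (add_le_add (eLpNorm_sub_comm _ _ _ _).le ?_)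
    exact (htri (hmA n) (hmU n) hY.1).trans (add_le_add_left hn _)
  have hlim := hAX'.add ((ENNReal.Tendsto.const_mul (hAX'.add (hAX'.comp hmt))
    (Or.inr ENNReal.ofNat_ne_top) (a := 2)).add hUY')
  simp only [add_zero, mul_zero] at hlim
  have h0 : eLpNorm (X - Y) 1 P = 0 := nonpos_iff_eq_zero.1 (ge_of_tendsto hlim hle)
  exact (sub_ae_eq_zero X Y).1 ((eLpNorm_eq_zero_iff (hX.1.sub hY.1) one_ne_zero).1 h0)

theorem ErgodicConv.congr {A : ℕ → Set S} {X Y : Ω → ℝ} (h : ErgodicConv P μ ξ A X)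
    (hXY : X =ᵐ[P] Y) : ErgodicConv P μ ξ A Y := by
  refine ⟨?_, h.2.congr fun n => eLpNorm_congr_ae ?_⟩
  · filter_upwards [h.1, hXY] with ω h1 h2
    rwa [← h2]
  · filter_upwards [hXY] with ω h2
    rw [h2]

theorem IsMuSequence.union {A B : ℕ → Set S} (hA : IsMuSequence μ A) (hB : IsMuSequence μ B) :
    IsMuSequence μ fun n => A n ∪ B n where
  measurableSet n := (hA.measurableSet n).union (hB.measurableSet n)
  mono _ _ hij := Set.union_subset_union (hA.mono hij) (hB.mono hij)
  measure_lt_top n := measure_union_lt_top (hA.measure_lt_top n) (hB.measure_lt_top n)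
  tendsto_measure := tendsto_nhds_top_mono' hA.tendsto_measure
    fun _ => measure_mono Set.subset_union_left

end Limit

end RandomMeasure

theorem mainTheorem9 {Ω S : Type*} [MeasurableSpace Ω] [MeasurableSpace S]
    (P : Measure Ω) [IsProbabilityMeasure P] (μ : Measure S) (hμ : RandomMeasure.IsAtomless μ)
    (ξ : Kernel Ω S) (hξ : RandomMeasure.IsExchangeable P μ ξ) :
    (∀ A : ℕ → Set S, RandomMeasure.IsMuSequence μ A → RandomMeasure.IsIntegrableSeq P ξ A →
      ∃ X : Ω → ℝ, Measurable X ∧ Integrable X P ∧ RandomMeasure.ErgodicConv P μ ξ A X) ∧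
    (SigmaFinite μ →
      (∃ C : Set S, MeasurableSet C ∧ 0 < μ C ∧ μ C < ∞ ∧ ∫⁻ ω, ξ ω C ∂P < ∞) →
      ∃ X : Ω → ℝ, Measurable X ∧ Integrable X P ∧
        ∀ A : ℕ → Set S, RandomMeasure.IsMuSequence μ A →
          RandomMeasure.IsIntegrableSeq P ξ A ∧ RandomMeasure.ErgodicConv P μ ξ A X) := by
  refine ⟨fun A hA hint => hξ.exists_ergodicConv hμ hA hint, ?_⟩
  rintro - ⟨C, hC, hC0, hCfin, hCint⟩
  have hint : ∀ A : ℕ → Set S, RandomMeasure.IsMuSequence μ A →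
      RandomMeasure.IsIntegrableSeq P ξ A := fun A hA n =>
    hξ.lintegral_lt_top hμ hC hC0 hCfin hCint (hA.measurableSet n) (hA.measure_lt_top n)
  by_cases hex : ∃ B : ℕ → Set S, RandomMeasure.IsMuSequence μ B
  · obtain ⟨B, hB⟩ := hex
    obtain ⟨X, hX, hXint, hBX⟩ := hξ.exists_ergodicConv hμ hB (hint B hB)
    refine ⟨X, hX, hXint, fun A hA => ⟨hint A hA, ?_⟩⟩
    obtain ⟨Y, -, hYint, hAY⟩ := hξ.exists_ergodicConv hμ hA (hint A hA)
    -- The union contains both sequences termwise, so its limit `Z` equals both `Y` and `X`.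
    have hU := hA.union hB
    obtain ⟨Z, -, hZint, hUZ⟩ := hξ.exists_ergodicConv hμ hU (hint _ hU)
    have h1 := hξ.limit_ae_eq_of_subset hμ hA hU (fun n => Set.subset_union_left) (hint A hA)
      hYint hZint hAY hUZ
    have h2 := hξ.limit_ae_eq_of_subset hμ hB hU (fun n => Set.subset_union_right) (hint B hB)
      hXint hZint hBX hUZ
    exact hAY.congr (h1.trans h2.symm)
  -- Without μ-sequences (for instance when `μ` is finite) any `X` serves.
  · exact ⟨0, measurable_zero, integrable_zero _ _ _, fun A hA => absurd ⟨A, hA⟩ hex⟩
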